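/- Let $0<s<1$. For $\varphi:\mathbb{R}\to\mathbb{R}$ and $x\in\mathbb{R}$, the one-dimensional fractional Laplacian is $$(-\Delta)^s\varphi(x)=C_s\,\mathrm{P.V.}\!\int_{-\infty}^{\infty}\frac{\varphi(x)-\varphi(y)}{|x-y|^{2s+1}}\,dy,\qquad C_s=\frac{4^s\,\Gamma(s+\tfrac12)}{\pi^{1/2}\,|\Gamma(-s)|}.$$ The fractional electrified disk problem $$(-\Delta)^sW_s(X)=0\ \text{ for }|X|>1,\qquad W_s(X)=1\ \text{ for }|X|<1,$$ admits the following non-constant solution $W_s:\mathbb{R}\to\mathbb{R}$: $W_s(X)=1$ for $|X|\le 1$, and for $|X|>1$ $$W_s(X)=\begin{cases}\dfrac{\sqrt{\pi}}{\Gamma(s)\,\Gamma(\frac32-s)}\,|X|^{2s-1}\Big(1-\dfrac1{X^2}\Big)^{s}\,{}_2F_1\!\Big(1,\tfrac12;\tfrac32-s;\dfrac1{X^2}\Big), & s\ne\tfrac12,\\[2mm] 1-\log\!\big(|X|+\sqrt{X^2-1}\big), & s=\tfrac12,\end{cases}$$ where ${}_2F_1$ is the Gauss hypergeometric function. Moreover,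 as $|X|\to\infty$, $$W_s(X)=\begin{cases}\mathfrak{b}_s|X|^{2s-1}+O(|X|^{2s-3}), & s\ne\tfrac12,\\ -\log(2|X|)+1+O(X^{-2}), & s=\tfrac12,\end{cases}\qquad \mathfrak{b}_s=\frac{\Gamma(1/2)}{\Gamma(\frac32-s)\,\Gamma(s)}.$$ -/

import Mathlib

/-- The normalizing constant `C_s = 4^s Γ(s + 1/2) / (√π |Γ(-s)|)` of the fractional Laplacian of
order `s` in dimension one. -/
noncomputable def fracLaplacianConst (s : ℝ) : ℝ :=
  (4 : ℝ) ^ s * Real.Gamma (s + 1 / 2) / (Real.sqrt Real.pi * |Real.Gamma (-s)|)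

/-- `HasFracLaplacianAt s φ x L`: the principal value integral
`C_s P.V. ∫ (φ x - φ y) / |x - y| ^ (2 s + 1) dy` exists and equals `L`. That is, the integrand is
integrable outside every symmetric neighbourhood `[x - δ, x + δ]`, and the truncated integrals
converge (to `L`, after multiplication by `C_s`) as `δ` decreases to `0`. -/
def HasFracLaplacianAt (s : ℝ) (φ : ℝ → ℝ) (x L : ℝ) : Prop :=
  (∀ δ : ℝ, 0 < δ →
    MeasureTheory.IntegrableOn (fun y : ℝ => (φ x - φ y) / |x - y| ^ (2 * s + 1))
      {y : ℝ | δ < |x - y|} MeasureTheory.volume) ∧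
  Filter.Tendsto
    (fun δ : ℝ => fracLaplacianConst s *
      ∫ y in {y : ℝ | δ < |x - y|}, (φ x - φ y) / |x - y| ^ (2 * s + 1))
    (nhdsWithin 0 (Set.Ioi 0)) (nhds L)

/-- `W` solves the fractional electrified disk problem of order `s`:
`(-Δ)^s W = 0` for `|X| > 1`, and `W = 1` for `|X| < 1`. -/
structure IsElectrifiedDiskSolution (s : ℝ) (W : ℝ → ℝ) : Prop where
  fracLaplacian_eq_zero : ∀ X : ℝ, 1 < |X| → HasFracLaplacianAt s W X 0
  eq_one : ∀ X : ℝ, |X| < 1 → W X = 1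

/-- The constant `𝔟_s = Γ(1/2) / (Γ(3/2 - s) Γ(s))`. -/
noncomputable def farFieldConst (s : ℝ) : ℝ :=
  Real.Gamma (1 / 2) / (Real.Gamma (3 / 2 - s) * Real.Gamma s)

/-!
Up to the choice of constants, the solution is an incomplete beta integral: it is even, continuous,
equal to `1` on `[-1, 1]`, and its derivative on `(1, ∞)` is `κ (x² - 1) ^ (s - 1)`. Such functions
are called electrified profiles below (`IsElectrifiedProfile`).

*Every electrified profile `g` is `s`-harmonic outside `[-1, 1]`*
(`IsElectrifiedProfile.hasFracLaplacianAt`). Fix `X > 1`. The Möbius map `ψ y = (X y - 1) / (X - y)`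
fixes `±1`, sends `X` to `∞`, and satisfies
`ψ² - 1 = (X² - 1) (y² - 1) / (X - y)²` and `ψ' = (X² - 1) / (X - y)²`, whence
`(g ∘ ψ)' = (X² - 1) ^ s · g'(y) · sign (X - y) · |X - y| ^ (-2 s)`. The right-hand side is what is
left of the integrand `(g X - g y) / |X - y| ^ (2 s + 1)` after an integration by parts, so the
integrand has the elementary primitive
`(sign (X - y) (g X - g y) |X - y| ^ (-2 s) + (X² - 1) ^ (-s) g (ψ y)) / (2 s)`.
Since `ψ (±∞) = -X`, the contributions of `±∞` cancel. The jump of the primitive across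
`[X - δ, X + δ]` consists of a second difference of `g` at `X` divided by `δ ^ (2 s)` and of the
increment of `g` between two points at distance `2 X` that escape to infinity; both tend to `0`.

*The stated formulas are electrified profiles.* For `s = 1/2` this is a direct differentiation. For
`s ≠ 1/2`, put `z = 1 / X²` and `Φ = ₂F₁(1, 1/2; 3/2 - s; ·)`. The two-term recursion of the
coefficients gives a first-order equation for `Φ` (`hypergeometric_one_half_ode`), by which
`z ^ (1/2 - s) (1 - z) ^ s Φ` has derivative `(1/2 - s) z ^ (-1/2 - s) (1 - z) ^ (s - 1)`.
Continuity at `|X| = 1` requires its limit as `z → 1`; splitting off the constant term of `Φ` leaves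
`(1/2) ∫₀ᶻ t ^ (1/2 - s) (1 - t) ^ (s - 1) dt`, so the limit is half of a complete beta integral
(`tendsto_rpow_mul_hypergeometric_one`), and this fixes the constant `𝔟_s`. The far-field expansions
express that `(1 - z) ^ s Φ z` and `log ((1 + √(1 - z)) / 2)` are differentiable at `z = 0`.
-/

open Filter Topology Set MeasureTheory

/-! ### Electrified profiles -/

/-- Even continuous functions that are constant on `[-1, 1]` and whose derivative on `(1, ∞)` is
`κ (x² - 1) ^ (s - 1)`. -/
structure IsElectrifiedProfile (s κ : ℝ) (g : ℝ → ℝ) : Prop where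
  continuous : Continuous g
  even : ∀ x, g (-x) = g x
  eq_of_abs_le : ∀ x, |x| ≤ 1 → g x = g 1
  hasDerivAt : ∀ x, 1 < x → HasDerivAt g (κ * (x ^ 2 - 1) ^ (s - 1)) x

/-- The derivative, away from `±1`, of an electrified profile. -/
noncomputable def profileSlope (s κ x : ℝ) : ℝ :=
  if 1 < x then κ * (x ^ 2 - 1) ^ (s - 1)
  else if x < -1 then -(κ * (x ^ 2 - 1) ^ (s - 1)) else 0

/-- The Möbius map `y ↦ (X y - 1) / (X - y)`: it fixes `±1` and sends `X` to `∞` and `∞` to `-X`. -/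
noncomputable def mobius (X y : ℝ) : ℝ := (X * y - 1) / (X - y)

lemma profileSlope_of_one_lt {s κ x : ℝ} (h : 1 < x) :
    profileSlope s κ x = κ * (x ^ 2 - 1) ^ (s - 1) := if_pos h

lemma profileSlope_of_lt_neg_one {s κ x : ℝ} (h : x < -1) :
    profileSlope s κ x = -(κ * (x ^ 2 - 1) ^ (s - 1)) := by
  rw [profileSlope, if_neg (by linarith), if_pos h]

lemma profileSlope_of_mem_Ioo {s κ x : ℝ} (h₁ : -1 < x) (h₂ : x < 1) :
    profileSlope s κ x = 0 := by
  rw [profileSlope, if_neg (by linarith), if_neg (by linarith)]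

namespace IsElectrifiedProfile

variable {s κ : ℝ} {g : ℝ → ℝ}

lemma hasDerivAt_of_ne (hg : IsElectrifiedProfile s κ g) {x : ℝ} (h₁ : x ≠ 1) (h₂ : x ≠ -1) :
    HasDerivAt g (profileSlope s κ x) x := by
  rcases lt_or_gt_of_ne h₁ with h | h
  · rcases lt_or_gt_of_ne h₂ with h' | h'
    · rw [profileSlope_of_lt_neg_one h']
      have h1 := (hg.hasDerivAt (-x) (by linarith)).scomp x (hasDerivAt_neg x)
      have h2 : g ∘ Neg.neg = g := funext hg.even
      rw [h2] at h1
      exact h1.congr_deriv (by simp)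
    · rw [profileSlope_of_mem_Ioo h' h]
      refine (hasDerivAt_const x (g 1)).congr_of_eventuallyEq ?_
      filter_upwards [Ioo_mem_nhds h' h] with y hy
      exact hg.eq_of_abs_le y (abs_le.2 ⟨hy.1.le, hy.2.le⟩)
  · rw [profileSlope_of_one_lt h]
    exact hg.hasDerivAt x h

/-- The derivatives compare as `(y² - 1) ^ (s - 1) ≤ (y - 1) ^ (s - 1)`. The exponent `s` is not sharp;
it is below `2 s`, which is all that convergence at infinity needs, and it serves every `s`. -/
lemma abs_sub_le_rpow_of_one_le (hg : IsElectrifiedProfile s κ g) (hs0 : 0 < s) (hs1 : s < 1)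
    {x : ℝ} (hx : 1 ≤ x) : |g x - g 1| ≤ |κ| / s * x ^ s := by
  have hd : ∀ σ : ℝ, |σ| = 1 → ∀ y, 1 < y →
      HasDerivAt (fun y => |κ| / s * (y - 1) ^ s - σ * (g y - g 1))
        (|κ| * (y - 1) ^ (s - 1) - σ * (κ * (y ^ 2 - 1) ^ (s - 1))) y := by
    intro σ _ y hy
    have h1 : HasDerivAt (fun y : ℝ => (y - 1) ^ s) (1 * s * (y - 1) ^ (s - 1)) y :=
      ((hasDerivAt_id y).sub_const 1).rpow_const (Or.inl (sub_pos.2 hy).ne')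
    exact ((h1.const_mul (|κ| / s)).sub
      (((hg.hasDerivAt y hy).sub_const (g 1)).const_mul σ)).congr_deriv (by field_simp)
  -- The signs `σ = ±1` give the two halves of the bound on `|g x - g 1|`.
  have key : ∀ σ : ℝ, |σ| = 1 → σ * (g x - g 1) ≤ |κ| / s * (x - 1) ^ s := by
    intro σ hσ
    have hmono : MonotoneOn (fun y => |κ| / s * (y - 1) ^ s - σ * (g y - g 1)) (Ici 1) := by
      refine monotoneOn_of_deriv_nonneg (convex_Ici 1) ?_ ?_ ?_
      · have h1 : Continuous fun y : ℝ => (y - 1) ^ s :=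
          (continuous_id.sub continuous_const).rpow_const fun _ => Or.inr hs0.le
        have := hg.continuous
        fun_prop
      · rw [interior_Ici]
        intro y hy
        exact (hd σ hσ y hy).differentiableAt.differentiableWithinAt
      · rw [interior_Ici]
        intro y (hy : 1 < y)
        rw [(hd σ hσ y hy).deriv]
        have h1 : (y ^ 2 - 1) ^ (s - 1) ≤ (y - 1) ^ (s - 1) :=
          Real.rpow_le_rpow_of_nonpos (by linarith) (by nlinarith) (by linarith)
        have h0 : 0 ≤ (y ^ 2 - 1) ^ (s - 1) := Real.rpow_nonneg (by nlinarith) _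
        have h2 : σ * (κ * (y ^ 2 - 1) ^ (s - 1)) ≤ |κ| * (y ^ 2 - 1) ^ (s - 1) := by
          refine (le_abs_self _).trans_eq ?_
          rw [abs_mul, abs_mul, hσ, one_mul, abs_of_nonneg h0]
        have h3 := mul_le_mul_of_nonneg_left h1 (abs_nonneg κ)
        linarith
    have := hmono self_mem_Ici (show x ∈ Ici 1 from hx) hx
    simp only [sub_self, mul_zero, Real.zero_rpow hs0.ne'] at this
    linarith
  have h1 : |κ| / s * (x - 1) ^ s ≤ |κ| / s * x ^ s := by
    gcongr; linarith
  have h2 := key 1 (by simp)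
  have h3 := key (-1) (by simp)
  rw [abs_le]
  constructor <;> linarith

lemma abs_sub_le_rpow (hg : IsElectrifiedProfile s κ g) (hs0 : 0 < s) (hs1 : s < 1)
    (x : ℝ) : |g x - g 1| ≤ |κ| / s * |x| ^ s := by
  rcases le_total |x| 1 with h | h
  · rw [hg.eq_of_abs_le x h]
    simp only [sub_self, abs_zero]
    positivity
  · have hx : g x = g |x| := by
      rcases abs_choice x with h | h <;> rw [h]
      exact (hg.even x).symm
    rw [hx]
    exact hg.abs_sub_le_rpow_of_one_le hs0 hs1 h

end IsElectrifiedProfile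

/-! ### The conformal identity -/

lemma hasDerivAt_mobius {X y : ℝ} (h : y ≠ X) :
    HasDerivAt (mobius X) ((X ^ 2 - 1) / (X - y) ^ 2) y := by
  have hne : X - y ≠ 0 := sub_ne_zero.2 h.symm
  exact ((((hasDerivAt_id y).const_mul X).sub_const 1).div ((hasDerivAt_id y).const_sub X)
    hne).congr_deriv (by simp only [id]; ring)

lemma mobius_sq_sub_one {X y : ℝ} (h : y ≠ X) :
    mobius X y ^ 2 - 1 = (X ^ 2 - 1) * (y ^ 2 - 1) / (X - y) ^ 2 := by
  have hne : X - y ≠ 0 := sub_ne_zero.2 h.symm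
  rw [mobius]
  field_simp
  ring

/-- The exponents cancel exactly: the kernel of order `2 s` absorbs the powers of `X - y` that come
from `mobius X y ^ 2 - 1` and from the derivative of the Möbius map. -/
lemma mobius_rpow_factor {s X y : ℝ} (hX : 1 < X) (h : y ≠ X) (hy : 0 < y ^ 2 - 1) :
    (X ^ 2 - 1) ^ (-s) * ((mobius X y ^ 2 - 1) ^ (s - 1) * ((X ^ 2 - 1) / (X - y) ^ 2)) =
      (y ^ 2 - 1) ^ (s - 1) * |X - y| ^ (-(2 * s)) := by
  have hd : 0 < |X - y| := abs_pos.2 (sub_ne_zero.2 h.symm)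
  have hX2 : 0 < X ^ 2 - 1 := by nlinarith
  have e1 : (X ^ 2 - 1) ^ (-s) = ((X ^ 2 - 1) ^ (s - 1) * (X ^ 2 - 1))⁻¹ := by
    rw [← Real.rpow_add_one hX2.ne', Real.rpow_neg hX2.le]
    ring_nf
  have e2 : |X - y| ^ (-(2 * s)) = ((|X - y| ^ 2) ^ (s - 1) * |X - y| ^ 2)⁻¹ := by
    rw [← Real.rpow_add_one (by positivity), Real.rpow_neg hd.le, ← Real.rpow_natCast,
      ← Real.rpow_mul hd.le]
    norm_num
  rw [mobius_sq_sub_one h, ← sq_abs (X - y), Real.div_rpow (by positivity) (by positivity),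
    Real.mul_rpow hX2.le hy.le, e1, e2]
  have : 0 < (X ^ 2 - 1) ^ (s - 1) := Real.rpow_pos_of_pos hX2 _
  have : 0 < (|X - y| ^ 2) ^ (s - 1) := Real.rpow_pos_of_pos (by positivity) _
  field_simp

/-- The conformal identity behind the whole argument: the Möbius map turns the slope of a profile
into the slope times the kernel `|X - y| ^ (-2 s)`, up to the constant `(X² - 1) ^ s`. -/
lemma profileSlope_mobius_of_lt {s κ X y : ℝ} (hX : 1 < X) (hyX : y < X) (h₁ : y ≠ 1)
    (h₂ : y ≠ -1) :
    (X ^ 2 - 1) ^ (-s) * (profileSlope s κ (mobius X y) * ((X ^ 2 - 1) / (X - y) ^ 2)) =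
      profileSlope s κ y * (X - y) ^ (-(2 * s)) := by
  have hd : 0 < X - y := sub_pos.2 hyX
  rcases lt_or_gt_of_ne h₁ with h | h
  · rcases lt_or_gt_of_ne h₂ with h' | h'
    · have hm : mobius X y < -1 := by
        rw [mobius, div_lt_iff₀ hd]; nlinarith
      have := mobius_rpow_factor (s := s) hX hyX.ne (by nlinarith)
      rw [abs_of_pos hd] at this
      rw [profileSlope_of_lt_neg_one h', profileSlope_of_lt_neg_one hm]
      linear_combination (-κ) * this
    · rw [profileSlope_of_mem_Ioo h' h, profileSlope_of_mem_Ioo]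
      · simp
      · rw [mobius, lt_div_iff₀ hd]; nlinarith
      · rw [mobius, div_lt_iff₀ hd]; nlinarith
  · have hm : 1 < mobius X y := by
      rw [mobius, lt_div_iff₀ hd]; nlinarith
    have := mobius_rpow_factor (s := s) hX hyX.ne (by nlinarith)
    rw [abs_of_pos hd] at this
    rw [profileSlope_of_one_lt h, profileSlope_of_one_lt hm]
    linear_combination κ * this

lemma profileSlope_mobius_of_gt {s κ X y : ℝ} (hX : 1 < X) (hyX : X < y) :
    (X ^ 2 - 1) ^ (-s) * (profileSlope s κ (mobius X y) * ((X ^ 2 - 1) / (X - y) ^ 2)) =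
      -(profileSlope s κ y * (y - X) ^ (-(2 * s))) := by
  have hd : X - y < 0 := sub_neg.2 hyX
  have hm : mobius X y < -1 := by
    rw [mobius, div_lt_iff_of_neg hd]; nlinarith
  have := mobius_rpow_factor (s := s) hX hyX.ne' (by nlinarith)
  rw [abs_of_neg hd, neg_sub] at this
  rw [profileSlope_of_one_lt (hX.trans hyX), profileSlope_of_lt_neg_one hm]
  linear_combination (-κ) * this

lemma mobius_ne_one {X y : ℝ} (hX : 1 < X) (hyX : y ≠ X) (h₁ : y ≠ 1) : mobius X y ≠ 1 := by
  rw [mobius, Ne, div_eq_one_iff_eq (sub_ne_zero.2 hyX.symm)]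
  intro h
  apply h₁
  have : (X + 1) * (y - 1) = 0 := by linarith
  rcases mul_eq_zero.1 this with h | h <;> linarith

lemma mobius_ne_neg_one {X y : ℝ} (hX : 1 < X) (hyX : y ≠ X) (h₂ : y ≠ -1) :
    mobius X y ≠ -1 := by
  rw [mobius, Ne, div_eq_iff (sub_ne_zero.2 hyX.symm)]
  intro h
  apply h₂
  have : (X - 1) * (y + 1) = 0 := by linarith
  rcases mul_eq_zero.1 this with h | h <;> linarith

/-! ### A primitive of the truncated integrand -/

/-- An antiderivative, on either side of `X`, of `2 s` times the integrand of the fractional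
Laplacian at `X`. -/
noncomputable def laplacianPrimitive (s : ℝ) (g : ℝ → ℝ) (X y : ℝ) : ℝ :=
  (if y < X then g X - g y else g y - g X) * |X - y| ^ (-(2 * s)) +
    (X ^ 2 - 1) ^ (-s) * g (mobius X y)

namespace IsElectrifiedProfile

variable {s κ : ℝ} {g : ℝ → ℝ}

lemma hasDerivAt_comp_mobius (hg : IsElectrifiedProfile s κ g) {X y : ℝ} (hX : 1 < X)
    (hyX : y ≠ X) (h₁ : y ≠ 1) (h₂ : y ≠ -1) :
    HasDerivAt (fun y => (X ^ 2 - 1) ^ (-s) * g (mobius X y))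
      ((X ^ 2 - 1) ^ (-s) * (profileSlope s κ (mobius X y) * ((X ^ 2 - 1) / (X - y) ^ 2))) y :=
  ((hg.hasDerivAt_of_ne (mobius_ne_one hX hyX h₁) (mobius_ne_neg_one hX hyX h₂)).comp y
    (hasDerivAt_mobius hyX)).const_mul _

lemma hasDerivAt_laplacianPrimitive (hg : IsElectrifiedProfile s κ g) {X y : ℝ} (hX : 1 < X)
    (hyX : y ≠ X) (h₁ : y ≠ 1) (h₂ : y ≠ -1) :
    HasDerivAt (laplacianPrimitive s g X)
      (2 * s * ((g X - g y) / |X - y| ^ (2 * s + 1))) y := by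
  have hmob := hg.hasDerivAt_comp_mobius hX hyX h₁ h₂
  rcases lt_or_gt_of_ne hyX with h | h
  · have hd : 0 < X - y := sub_pos.2 h
    rw [profileSlope_mobius_of_lt hX h h₁ h₂] at hmob
    have hpow : HasDerivAt (fun y => (X - y) ^ (-(2 * s)))
        (-1 * -(2 * s) * (X - y) ^ (-(2 * s) - 1)) y :=
      ((hasDerivAt_id y).const_sub X).rpow_const (Or.inl hd.ne')
    have := (((hg.hasDerivAt_of_ne h₁ h₂).const_sub (g X)).mul hpow).add hmob
    refine (this.congr_of_eventuallyEq ?_).congr_deriv ?_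
    · filter_upwards [Iio_mem_nhds h] with z (hz : z < X)
      simp [laplacianPrimitive, hz, abs_of_pos (sub_pos.2 hz)]
    · rw [abs_of_pos hd, show -(2 * s) - 1 = -(2 * s + 1) by ring, Real.rpow_neg hd.le (2 * s + 1)]
      ring
  · have hd : 0 < y - X := sub_pos.2 h
    rw [profileSlope_mobius_of_gt hX h] at hmob
    have hpow : HasDerivAt (fun y => (y - X) ^ (-(2 * s)))
        (1 * -(2 * s) * (y - X) ^ (-(2 * s) - 1)) y :=
      ((hasDerivAt_id y).sub_const X).rpow_const (Or.inl hd.ne')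
    have := (((hg.hasDerivAt_of_ne h₁ h₂).sub_const (g X)).mul hpow).add hmob
    refine (this.congr_of_eventuallyEq ?_).congr_deriv ?_
    · filter_upwards [Ioi_mem_nhds h] with z (hz : X < z)
      simp [laplacianPrimitive, hz.not_gt, abs_sub_comm X z, abs_of_pos (sub_pos.2 hz)]
    · rw [abs_sub_comm X y, abs_of_pos hd, show -(2 * s) - 1 = -(2 * s + 1) by ring,
        Real.rpow_neg hd.le (2 * s + 1)]
      ring

lemma continuousOn_laplacianPrimitive (hg : IsElectrifiedProfile s κ g) {X : ℝ} :
    ContinuousOn (laplacianPrimitive s g X) {X}ᶜ := by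
  intro y (hyX : y ≠ X)
  refine ContinuousAt.continuousWithinAt ?_
  have hmob : ContinuousAt (fun y => (X ^ 2 - 1) ^ (-s) * g (mobius X y)) y :=
    (hg.continuous.continuousAt.comp (hasDerivAt_mobius hyX).continuousAt).const_mul _
  have habs : ContinuousAt (fun y => |X - y| ^ (-(2 * s))) y :=
    (by fun_prop : ContinuousAt (fun y => |X - y|) y).rpow_const
      (Or.inl (abs_pos.2 (sub_ne_zero.2 hyX.symm)).ne')
  have hgc := hg.continuous
  rcases lt_or_gt_of_ne hyX with h | h
  · refine (((continuousAt_const (y := g X)).sub hgc.continuousAt).mul habs |>.add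
      hmob).congr ?_
    filter_upwards [Iio_mem_nhds h] with z (hz : z < X)
    simp [laplacianPrimitive, hz]
  · refine ((hgc.continuousAt.sub (continuousAt_const (y := g X))).mul habs |>.add
      hmob).congr ?_
    filter_upwards [Ioi_mem_nhds h] with z (hz : X < z)
    simp [laplacianPrimitive, hz.not_gt]

/-- Off `[X - δ, X + δ]` the integrand is dominated by a multiple of `(1 + |y|) ^ (-(1 + s))`. -/
lemma integrableOn_laplacian (hg : IsElectrifiedProfile s κ g) (hs0 : 0 < s) (hs1 : s < 1)
    (X : ℝ) {δ : ℝ} (hδ : 0 < δ) :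
    IntegrableOn (fun y => (g X - g y) / |X - y| ^ (2 * s + 1)) {y | δ < |X - y|} := by
  set A := |κ| / s * (|X| ^ s + 1) with hA
  set K := (1 + |X|) / δ + 1 with hK
  have hint : Integrable (fun y : ℝ => A * K ^ (2 * s + 1) * (1 + ‖y‖) ^ (-(1 + s))) :=
    (integrable_one_add_norm (by simp [hs0])).const_mul _
  refine Integrable.mono' hint.integrableOn ?_ ?_
  · have := hg.continuous.measurable
    exact Measurable.aestronglyMeasurable (by fun_prop)
  · refine ae_restrict_of_forall_mem (measurableSet_lt (by fun_prop) (by fun_prop)) ?_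
    intro y (hy : δ < |X - y|)
    have hpos : 0 < |X - y| := hδ.trans hy
    have hnum : |g X - g y| ≤ A * (1 + |y|) ^ s := by
      have h1 := hg.abs_sub_le_rpow hs0 hs1 X
      have h2 := hg.abs_sub_le_rpow hs0 hs1 y
      have h3 : |g X - g y| ≤ |g X - g 1| + |g y - g 1| := by
        rw [show g X - g y = (g X - g 1) - (g y - g 1) by ring]
        exact abs_sub _ _
      have h4 : |y| ^ s ≤ (1 + |y|) ^ s := by gcongr; linarith
      have h5 : 1 ≤ (1 + |y|) ^ s := Real.one_le_rpow (by linarith [abs_nonneg y]) hs0.le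
      have h6 : |X| ^ s ≤ |X| ^ s * (1 + |y|) ^ s := le_mul_of_one_le_right (by positivity) h5
      calc |g X - g y| ≤ |κ| / s * |X| ^ s + |κ| / s * |y| ^ s := by linarith
        _ ≤ |κ| / s * (|X| ^ s * (1 + |y|) ^ s) + |κ| / s * (1 + |y|) ^ s := by gcongr
        _ = _ := by rw [hA]; ring
    have hden : 1 + |y| ≤ K * |X - y| := by
      have h1 : |y| ≤ |X| + |X - y| := by
        have := abs_sub X (X - y)
        simpa using this
      have h2 : 1 + |X| ≤ (1 + |X|) / δ * |X - y| := by
        rw [div_mul_eq_mul_div, le_div_iff₀ hδ]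
        gcongr
      rw [hK]; linarith
    have hKpos : 0 < K := by positivity
    have hy1 : 0 < 1 + |y| := by positivity
    have hpow : (1 + |y|) ^ (2 * s + 1) ≤ K ^ (2 * s + 1) * |X - y| ^ (2 * s + 1) := by
      rw [← Real.mul_rpow hKpos.le hpos.le]
      gcongr
    have hexp : (1 + |y|) ^ (-(1 + s)) = (1 + |y|) ^ s / (1 + |y|) ^ (2 * s + 1) := by
      rw [← Real.rpow_sub hy1]; ring_nf
    rw [Real.norm_eq_abs, abs_div, abs_of_pos (Real.rpow_pos_of_pos hpos _), Real.norm_eq_abs,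
      hexp, div_le_iff₀ (Real.rpow_pos_of_pos hpos _)]
    have hq : 0 < (1 + |y|) ^ (2 * s + 1) := Real.rpow_pos_of_pos hy1 _
    have hA0 : 0 ≤ A := by positivity
    calc |g X - g y| ≤ A * (1 + |y|) ^ s := hnum
      _ = A * ((1 + |y|) ^ s / (1 + |y|) ^ (2 * s + 1)) * (1 + |y|) ^ (2 * s + 1) := by
          field_simp
      _ ≤ A * ((1 + |y|) ^ s / (1 + |y|) ^ (2 * s + 1)) *
          (K ^ (2 * s + 1) * |X - y| ^ (2 * s + 1)) := by gcongr
      _ = _ := by ring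

end IsElectrifiedProfile

/-! ### Harmonicity of the profiles -/

namespace IsElectrifiedProfile

variable {s κ : ℝ} {g : ℝ → ℝ}

/-- At infinity, the first term of the primitive is `O(|y| ^ (-s))`, and the Möbius map tends
to `-X`. -/
lemma tendsto_laplacianPrimitive (hg : IsElectrifiedProfile s κ g) (hs0 : 0 < s) (hs1 : s < 1)
    (X : ℝ) : Tendsto (laplacianPrimitive s g X) (Bornology.cobounded ℝ)
      (𝓝 ((X ^ 2 - 1) ^ (-s) * g X)) := by
  have habs : Tendsto (fun y : ℝ => |X - y|) (Bornology.cobounded ℝ) atTop := by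
    have h := tendsto_norm_cobounded_atTop (E := ℝ)
    refine tendsto_atTop_mono (f := fun y : ℝ => -|X| + ‖y‖) (fun y => ?_)
      (tendsto_atTop_add_const_left _ _ h)
    have := abs_sub X (X - y)
    simp only [sub_sub_cancel] at this
    rw [Real.norm_eq_abs]
    linarith
  have hfirst : Tendsto (fun y => (if y < X then g X - g y else g y - g X) *
      |X - y| ^ (-(2 * s))) (Bornology.cobounded ℝ) (𝓝 0) := by
    set A := |κ| / s with hA
    have hA0 : 0 ≤ A := by positivity
    have hlim : Tendsto (fun y : ℝ => 3 * A * |X - y| ^ (-s)) (Bornology.cobounded ℝ) (𝓝 0) := by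
      simpa using ((tendsto_rpow_neg_atTop hs0).comp habs).const_mul (3 * A)
    refine squeeze_zero_norm' ?_ hlim
    filter_upwards [habs.eventually_ge_atTop (max 1 |X|)] with y hy
    have h1 : 1 ≤ |X - y| := (le_max_left _ _).trans hy
    have hX : |X| ≤ |X - y| := (le_max_right _ _).trans hy
    have hpos : 0 < |X - y| := by linarith
    have hsplit : |X - y| ^ (-s) = |X - y| ^ s * |X - y| ^ (-(2 * s)) := by
      rw [← Real.rpow_add hpos]; ring_nf
    have hnum : |if y < X then g X - g y else g y - g X| ≤ 3 * A * |X - y| ^ s := by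
      have e : |if y < X then g X - g y else g y - g X| = |g X - g y| := by
        split_ifs
        · rfl
        · exact abs_sub_comm _ _
      have b1 := hg.abs_sub_le_rpow hs0 hs1 X
      have b2 := hg.abs_sub_le_rpow hs0 hs1 y
      have b3 : |g X - g y| ≤ |g X - g 1| + |g y - g 1| := by
        rw [show g X - g y = (g X - g 1) - (g y - g 1) by ring]
        exact abs_sub _ _
      have b4 : |X| ^ s ≤ |X - y| ^ s := by gcongr
      have b5 : |y| ^ s ≤ 2 * |X - y| ^ s := by
        have h2 : |y| ≤ 2 * |X - y| := by
          have := abs_sub X (X - y)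
          simp only [sub_sub_cancel] at this
          linarith
        calc |y| ^ s ≤ (2 * |X - y|) ^ s := by gcongr
          _ = 2 ^ s * |X - y| ^ s := Real.mul_rpow (by norm_num) hpos.le
          _ ≤ 2 ^ (1 : ℝ) * |X - y| ^ s := by gcongr; norm_num
          _ = _ := by rw [Real.rpow_one]
      rw [e]
      have b6 := mul_le_mul_of_nonneg_left b4 hA0
      have b7 := mul_le_mul_of_nonneg_left b5 hA0
      linarith
    rw [norm_mul, Real.norm_eq_abs, Real.norm_eq_abs, abs_of_pos (Real.rpow_pos_of_pos hpos _),
      hsplit, ← mul_assoc]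
    gcongr
  have hmob : Tendsto (mobius X) (Bornology.cobounded ℝ) (𝓝 (-X)) := by
    have hinv : Tendsto (fun y : ℝ => (X - y)⁻¹) (Bornology.cobounded ℝ) (𝓝 0) := by
      refine tendsto_inv₀_cobounded.comp ?_
      rw [← tendsto_norm_atTop_iff_cobounded]
      exact habs
    have h1 : Tendsto (fun y : ℝ => -X + (X ^ 2 - 1) * (X - y)⁻¹) (Bornology.cobounded ℝ)
        (𝓝 (-X + (X ^ 2 - 1) * 0)) := (hinv.const_mul _).const_add _
    rw [mul_zero, add_zero] at h1
    refine h1.congr' ?_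
    filter_upwards [habs.eventually_gt_atTop 0] with y hy
    have : X - y ≠ 0 := abs_pos.1 hy
    rw [mobius]
    field_simp
    ring
  have hsecond : Tendsto (fun y => (X ^ 2 - 1) ^ (-s) * g (mobius X y)) (Bornology.cobounded ℝ)
      (𝓝 ((X ^ 2 - 1) ^ (-s) * g X)) := by
    have := ((hg.continuous.tendsto (-X)).comp hmob).const_mul ((X ^ 2 - 1) ^ (-s))
    rwa [hg.even] at this
  have := hfirst.add hsecond
  rwa [zero_add] at this

/-- The contributions of `±∞` cancel, and the truncated integral is the jump of the primitive
across `[X - δ, X + δ]`. -/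
lemma integral_laplacian (hg : IsElectrifiedProfile s κ g) (hs0 : 0 < s) (hs1 : s < 1)
    {X : ℝ} (hX : 1 < X) {δ : ℝ} (hδ : 0 < δ) :
    2 * s * ∫ y in {y | δ < |X - y|}, (g X - g y) / |X - y| ^ (2 * s + 1) =
      laplacianPrimitive s g X (X - δ) - laplacianPrimitive s g X (X + δ) := by
  have hset : {y | δ < |X - y|} = Iio (X - δ) ∪ Ioi (X + δ) := by
    ext y
    simp only [mem_ofPred_eq, lt_abs, mem_union, mem_Iio, mem_Ioi]
    constructor <;> rintro (h | h)
    · left; linarith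
    · right; linarith
    · left; linarith
    · right; linarith
  have hint := (hg.integrableOn_laplacian hs0 hs1 X hδ).const_mul (2 * s)
  rw [hset] at hint
  change IntegrableOn _ _ _ at hint
  have hintL := hint.mono_set subset_union_left
  rw [← integrableOn_Iic_iff_integrableOn_Iio] at hintL
  have hintR := hint.mono_set subset_union_right
  have hlim := hg.tendsto_laplacianPrimitive hs0 hs1 X
  rw [IsOrderBornology.cobounded_eq, tendsto_sup] at hlim
  have hR : ∫ y in Ioi (X + δ), 2 * s * ((g X - g y) / |X - y| ^ (2 * s + 1)) =
      (X ^ 2 - 1) ^ (-s) * g X - laplacianPrimitive s g X (X + δ) := by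
    refine integral_Ioi_of_hasDerivAt_of_tendsto' (fun y (hy : X + δ ≤ y) => ?_) hintR
      hlim.2
    exact hg.hasDerivAt_laplacianPrimitive hX (by linarith) (by linarith) (by linarith)
  have hL : ∫ y in Iic (X - δ), 2 * s * ((g X - g y) / |X - y| ^ (2 * s + 1)) =
      laplacianPrimitive s g X (X - δ) - (X ^ 2 - 1) ^ (-s) * g X := by
    refine tendsto_nhds_unique (intervalIntegral_tendsto_integral_Iic _ hintL tendsto_id) ?_
    refine Tendsto.congr' ?_ (hlim.1.const_sub _)
    filter_upwards [Iic_mem_atBot (X - δ)] with a (ha : a ≤ X - δ)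
    symm
    -- The slope of `g` may blow up at `±1`, where the primitive is only continuous.
    refine integral_eq_of_hasDerivAt_off_countable_of_le _ _ ha
      (s := {1, -1}) (by simp) ?_ ?_ ?_
    · refine hg.continuousOn_laplacianPrimitive.mono fun y hy => ?_
      simp only [mem_compl_iff, mem_singleton_iff]
      have := hy.2
      linarith
    · rintro y ⟨hy, hy'⟩
      simp only [mem_insert_iff, mem_singleton_iff, not_or] at hy'
      exact hg.hasDerivAt_laplacianPrimitive hX (by linarith [hy.2]) hy'.1 hy'.2
    · exact (intervalIntegrable_iff_integrableOn_Ioc_of_le ha).2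
        (hintL.mono_set Ioc_subset_Iic_self)
  rw [hset, ← integral_const_mul, setIntegral_union ?_ measurableSet_Ioi
    (hint.mono_set subset_union_left) hintR, ← integral_Iic_eq_integral_Iio, hL, hR]
  · ring
  · rw [Set.disjoint_left]
    intro y (hy : y < X - δ) (hy' : X + δ < y)
    linarith

/-- The second difference of `g` at `X > 1` is `o(δ ^ (2 s))`, since `g` is twice differentiable
there. -/
lemma tendsto_second_difference (hg : IsElectrifiedProfile s κ g) (hs0 : 0 < s) (hs1 : s < 1)
    {X : ℝ} (hX : 1 < X) :
    Tendsto (fun δ => (2 * g X - g (X - δ) - g (X + δ)) / δ ^ (2 * s)) (𝓝[>] 0) (𝓝 0) := by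
  set p : ℝ → ℝ := fun x => κ * (x ^ 2 - 1) ^ (s - 1) with hp
  have hnear : ∀ᶠ δ : ℝ in 𝓝[>] 0, 0 < δ ∧ 1 < X - δ := by
    filter_upwards [Ioo_mem_nhdsGT (show (0 : ℝ) < X - 1 by linarith)] with δ hδ
    exact ⟨hδ.1, by linarith [hδ.2]⟩
  obtain ⟨p', hp'⟩ : ∃ p', HasDerivAt p p' X := by
    have h1 : HasDerivAt (fun x : ℝ => x ^ 2 - 1) (2 * X) X := by
      simpa using (hasDerivAt_pow 2 X).sub_const 1
    exact ⟨_, (h1.rpow_const (p := s - 1) (Or.inl (by nlinarith))).const_mul κ⟩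
  -- By L'Hôpital's rule the quotient is like `δ ^ (2 - 2 s)` times a difference quotient of `p`.
  refine HasDerivAt.lhopital_zero_nhdsGT (f' := fun δ => p (X - δ) - p (X + δ))
    (g' := fun δ => 2 * s * δ ^ (2 * s - 1)) ?_ ?_ ?_ ?_ ?_ ?_
  · filter_upwards [hnear] with δ hδ
    have h1 := (hg.hasDerivAt (X - δ) hδ.2).scomp δ ((hasDerivAt_id δ).const_sub X)
    have h2 := (hg.hasDerivAt (X + δ) (by linarith)).scomp δ ((hasDerivAt_id δ).const_add X)
    exact (((hasDerivAt_const δ (2 * g X)).sub h1).sub h2).congr_deriv (by simp [hp])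
  · filter_upwards [hnear] with δ hδ
    exact Real.hasDerivAt_rpow_const (Or.inl hδ.1.ne')
  · filter_upwards [hnear] with δ hδ
    have := Real.rpow_pos_of_pos hδ.1 (2 * s - 1)
    positivity
  · have hc : Continuous fun δ => 2 * g X - g (X - δ) - g (X + δ) := by
      have := hg.continuous
      fun_prop
    have := hc.tendsto 0
    simp only [sub_zero, add_zero] at this
    rw [show 2 * g X - g X - g X = 0 by ring] at this
    exact this.mono_left nhdsWithin_le_nhds
  · have := (Real.continuousAt_rpow_const 0 (2 * s) (Or.inr (by linarith))).tendsto
    rw [Real.zero_rpow (by linarith)] at this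
    exact this.mono_left nhdsWithin_le_nhds
  · have hq : HasDerivAt (fun δ => p (X - δ) - p (X + δ)) (-p' - p') 0 := by
      have e1 : HasDerivAt p p' (X - id 0) := by simpa using hp'
      have e2 : HasDerivAt p p' (X + id 0) := by simpa using hp'
      have h1 := e1.scomp (0 : ℝ) ((hasDerivAt_id (0 : ℝ)).const_sub X)
      have h2 := e2.scomp (0 : ℝ) ((hasDerivAt_id (0 : ℝ)).const_add X)
      exact (h1.sub h2).congr_deriv (by simp)
    have hslope := hq.tendsto_slope_zero_right
    have hpow : Tendsto (fun δ : ℝ => δ ^ (2 - 2 * s)) (𝓝[>] 0) (𝓝 0) := by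
      have := (Real.continuousAt_rpow_const 0 (2 - 2 * s) (Or.inr (by linarith))).tendsto
      rw [Real.zero_rpow (by linarith)] at this
      exact this.mono_left nhdsWithin_le_nhds
    have hprod := (hslope.mul hpow).const_mul (1 / (2 * s))
    simp only [mul_zero, zero_add, sub_zero, add_zero, sub_self, smul_eq_mul] at hprod
    refine hprod.congr' ?_
    filter_upwards [hnear] with δ hδ
    have e : δ ^ (2 - 2 * s) = δ / δ ^ (2 * s - 1) := by
      nth_rewrite 2 [← Real.rpow_one δ]
      rw [← Real.rpow_sub hδ.1]
      ring_nf
    have := Real.rpow_pos_of_pos hδ.1 (2 * s - 1)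
    have := hδ.1
    rw [e]
    field_simp

/-- The slope of `g` tends to `0`, hence so does its increment over intervals of fixed length. -/
lemma tendsto_increment (hg : IsElectrifiedProfile s κ g) (hs1 : s < 1) {X : ℝ} (hX : 0 < X) :
    Tendsto (fun R => g (R - X) - g (R + X)) atTop (𝓝 0) := by
  have hlim : Tendsto (fun R : ℝ => |κ| * ((R - X) ^ 2 - 1) ^ (s - 1) * (2 * X)) atTop (𝓝 0) := by
    have h1 : Tendsto (fun R : ℝ => (R - X) ^ 2 - 1) atTop atTop :=
      tendsto_atTop_add_const_right _ _
        ((tendsto_pow_atTop two_ne_zero).comp (tendsto_atTop_add_const_right _ (-X) tendsto_id))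
    have h2 := (tendsto_rpow_neg_atTop (show 0 < 1 - s by linarith)).comp h1
    simpa using (h2.const_mul |κ|).mul_const (2 * X)
  refine squeeze_zero_norm' ?_ hlim
  filter_upwards [eventually_gt_atTop (X + 1)] with R hR
  rw [norm_sub_rev]
  have hb := (convex_Icc (R - X) (R + X)).norm_image_sub_le_of_norm_hasDerivWithin_le
    (f := g) (f' := fun x => κ * (x ^ 2 - 1) ^ (s - 1))
    (C := |κ| * ((R - X) ^ 2 - 1) ^ (s - 1))
    (fun x hx => (hg.hasDerivAt x (by linarith [hx.1])).hasDerivWithinAt) ?_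
    (left_mem_Icc.2 (by linarith)) (right_mem_Icc.2 (by linarith))
  · refine hb.trans_eq ?_
    rw [Real.norm_eq_abs, show R + X - (R - X) = 2 * X by ring,
      abs_of_pos (by linarith : 0 < 2 * X)]
  · intro x hx
    have h0 : 0 < (R - X) ^ 2 - 1 := by nlinarith
    have h1 : (R - X) ^ 2 - 1 ≤ x ^ 2 - 1 := by nlinarith [hx.1]
    rw [norm_mul, Real.norm_eq_abs, Real.norm_eq_abs,
      abs_of_nonneg (Real.rpow_nonneg (h0.le.trans h1) _)]
    exact mul_le_mul_of_nonneg_left (Real.rpow_le_rpow_of_nonpos h0 h1 (by linarith))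
      (abs_nonneg _)

/-- With `R = (X² - 1) / δ`, the Möbius map sends `X ∓ δ` to `±R - X`, so the jump of the primitive
is a second difference at `X` plus the increment of `g` from `R + X` to `R - X`. -/
lemma hasFracLaplacianAt_of_one_lt (hg : IsElectrifiedProfile s κ g) (hs0 : 0 < s) (hs1 : s < 1)
    {X : ℝ} (hX : 1 < X) : HasFracLaplacianAt s g X 0 := by
  refine ⟨fun δ hδ => hg.integrableOn_laplacian hs0 hs1 X hδ, ?_⟩
  have hX2 : 0 < X ^ 2 - 1 := by nlinarith
  have hR : Tendsto (fun δ : ℝ => (X ^ 2 - 1) / δ) (𝓝[>] 0) atTop := by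
    simpa [div_eq_mul_inv] using tendsto_inv_nhdsGT_zero.const_mul_atTop hX2
  have hlim := (((hg.tendsto_second_difference hs0 hs1 hX).add
    (((hg.tendsto_increment hs1 (by linarith : 0 < X)).comp hR).const_mul
      ((X ^ 2 - 1) ^ (-s)))).const_mul (1 / (2 * s))).const_mul (fracLaplacianConst s)
  simp only [mul_zero, add_zero] at hlim
  refine hlim.congr' ?_
  filter_upwards [self_mem_nhdsWithin] with δ (hδ : 0 < δ)
  have h := hg.integral_laplacian hs0 hs1 hX hδ
  have hm1 : mobius X (X - δ) = (X ^ 2 - 1) / δ - X := by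
    rw [mobius, sub_sub_cancel]; field_simp; ring
  have hm2 : mobius X (X + δ) = -((X ^ 2 - 1) / δ + X) := by
    rw [mobius, sub_add_cancel_left]; field_simp; ring
  congr 1
  rw [one_div, inv_mul_eq_iff_eq_mul₀ (by positivity), h, laplacianPrimitive, laplacianPrimitive,
    hm1, hm2, hg.even, if_pos (by linarith), if_neg (by linarith), sub_sub_cancel,
    sub_add_cancel_left, abs_neg, abs_of_pos hδ, Real.rpow_neg hδ.le]
  simp only [Function.comp]
  ring

end IsElectrifiedProfile

/-- The fractional Laplacian commutes with the reflection `x ↦ -x`. -/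
lemma HasFracLaplacianAt.neg_of_even {s : ℝ} {φ : ℝ → ℝ} (hφ : ∀ x, φ (-x) = φ x) {x L : ℝ}
    (h : HasFracLaplacianAt s φ x L) : HasFracLaplacianAt s φ (-x) L := by
  have hpre (δ : ℝ) : (fun y : ℝ => -y) ⁻¹' {y | δ < |x - y|} = {y | δ < |-x - y|} := by
    ext y
    simp only [mem_preimage, mem_ofPred_eq]
    rw [show x - -y = -(-x - y) by ring, abs_neg]
  have hfun : (fun y => (φ (-x) - φ y) / |-x - y| ^ (2 * s + 1)) =
      (fun y => (φ x - φ y) / |x - y| ^ (2 * s + 1)) ∘ fun y => -y := by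
    ext y
    simp only [Function.comp]
    rw [hφ, hφ, show x - -y = -(-x - y) by ring, abs_neg]
  have hmp : MeasurePreserving (fun y : ℝ => -y) := Measure.measurePreserving_neg _
  have hme : MeasurableEmbedding (fun y : ℝ => -y) := (MeasurableEquiv.neg ℝ).measurableEmbedding
  refine ⟨fun δ hδ => ?_, h.2.congr fun δ => ?_⟩
  · rw [hfun, ← hpre]
    exact (hmp.integrableOn_comp_preimage hme).2 (h.1 δ hδ)
  · rw [← hmp.setIntegral_preimage_emb hme, hpre]
    congr 1
    exact integral_congr_ae (Eventually.of_forall fun y => (congrFun hfun y).symm)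

/-- Electrified profiles are `s`-harmonic outside `[-1, 1]`. -/
lemma IsElectrifiedProfile.hasFracLaplacianAt {s κ : ℝ} {g : ℝ → ℝ}
    (hg : IsElectrifiedProfile s κ g) (hs0 : 0 < s) (hs1 : s < 1) {X : ℝ} (hX : 1 < |X|) :
    HasFracLaplacianAt s g X 0 := by
  rcases lt_abs.1 hX with h | h
  · exact hg.hasFracLaplacianAt_of_one_lt hs0 hs1 h
  · simpa using (hg.hasFracLaplacianAt_of_one_lt hs0 hs1 h).neg_of_even hg.even

/-! ### The function `₂F₁(1, 1/2; c; ·)` -/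

/-- The coefficient `(1/2)ₙ / (c)ₙ` of `zⁿ` in `₂F₁(1, 1/2; c; z)`. -/
noncomputable def halfCoeff (c : ℝ) (n : ℕ) : ℝ :=
  (ascPochhammer ℝ n).eval (1 / 2) / (ascPochhammer ℝ n).eval c

lemma halfCoeff_zero (c : ℝ) : halfCoeff c 0 = 1 := by simp [halfCoeff]

lemma halfCoeff_succ {c : ℝ} (hc : 0 < c) (n : ℕ) :
    (c + n) * halfCoeff c (n + 1) = (1 / 2 + n) * halfCoeff c n := by
  have h1 : 0 < (ascPochhammer ℝ n).eval c := ascPochhammer_pos n c hc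
  have h2 : 0 < c + n := by positivity
  rw [halfCoeff, halfCoeff, ascPochhammer_succ_eval, ascPochhammer_succ_eval]
  field_simp

lemma halfCoeff_pos {c : ℝ} (hc : 0 < c) (n : ℕ) : 0 < halfCoeff c n :=
  div_pos (ascPochhammer_pos n _ (by norm_num)) (ascPochhammer_pos n c hc)

lemma halfCoeff_le_one {c : ℝ} (hc : 1 / 2 ≤ c) (n : ℕ) : halfCoeff c n ≤ 1 := by
  induction n with
  | zero => rw [halfCoeff_zero]
  | succ n ih =>
    have h := halfCoeff_succ (by linarith : 0 < c) n
    have h2 : 0 < c + n := by positivity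
    have h3 : (0 : ℝ) ≤ 1 / 2 + n := by positivity
    refine le_of_mul_le_mul_left (a := c + n) ?_ h2
    rw [h]
    nlinarith

lemma hypergeometric_one_half_eq_tsum (c : ℝ) :
    ordinaryHypergeometric (1 : ℝ) (1 / 2 : ℝ) c = fun z : ℝ => ∑' n, halfCoeff c n * z ^ n := by
  rw [ordinaryHypergeometric_eq_tsum]
  funext z
  refine tsum_congr fun n => ?_
  have : (n.factorial : ℝ) ≠ 0 := by positivity
  rw [ascPochhammer_eval_one, inv_mul_cancel₀ this, one_mul, smul_eq_mul, halfCoeff,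
    ← div_eq_mul_inv]

lemma summable_halfCoeff_mul_pow {c : ℝ} (hc : 1 / 2 ≤ c) {z : ℝ} (hz : |z| < 1) :
    Summable fun n => halfCoeff c n * z ^ n := by
  refine Summable.of_norm_bounded (summable_geometric_of_lt_one (abs_nonneg z) hz) fun n => ?_
  rw [norm_mul, norm_pow, Real.norm_eq_abs, Real.norm_eq_abs,
    abs_of_pos (halfCoeff_pos (by linarith) n)]
  exact mul_le_of_le_one_left (by positivity) (halfCoeff_le_one hc n)

lemma summable_nat_mul_halfCoeff_mul_pow {c : ℝ} (hc : 1 / 2 ≤ c) {z : ℝ} (hz : |z| < 1) :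
    Summable fun n : ℕ => halfCoeff c n * (n * z ^ (n - 1)) := by
  have h0 : Summable fun n : ℕ => ((n + 1 : ℕ) : ℝ) * |z| ^ n := by
    have h1 := summable_pow_mul_geometric_of_norm_lt_one 1 (r := |z|) (by simpa using hz)
    have h2 := summable_geometric_of_lt_one (abs_nonneg z) hz
    refine (h1.add h2).congr fun n => ?_
    push_cast; ring
  refine (summable_nat_add_iff 1).1 ?_
  refine Summable.of_norm_bounded h0 fun n => ?_
  rw [norm_mul, norm_mul, norm_pow, Real.norm_eq_abs, Real.norm_eq_abs, Real.norm_eq_abs,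
    abs_of_pos (halfCoeff_pos (by linarith) _), Nat.abs_cast, Nat.add_sub_cancel]
  exact mul_le_of_le_one_left (by positivity) (halfCoeff_le_one hc _)

lemma hasDerivAt_hypergeometric_one_half {c : ℝ} (hc : 1 / 2 ≤ c) {z : ℝ} (hz : |z| < 1) :
    HasDerivAt (ordinaryHypergeometric (1 : ℝ) (1 / 2 : ℝ) c)
      (∑' n : ℕ, halfCoeff c n * (n * z ^ (n - 1))) z := by
  obtain ⟨r, hzr, hr⟩ := exists_between hz
  have hr0 : 0 ≤ r := (abs_nonneg z).trans hzr.le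
  rw [hypergeometric_one_half_eq_tsum]
  refine hasDerivAt_tsum_of_isPreconnected (t := Ioo (-r) r) (y₀ := 0)
    (g := fun n (y : ℝ) => halfCoeff c n * y ^ n)
    (g' := fun n (y : ℝ) => halfCoeff c n * (n * y ^ (n - 1)))
    (summable_nat_mul_halfCoeff_mul_pow hc (z := r) (by rwa [abs_of_nonneg hr0])) isOpen_Ioo
    isPreconnected_Ioo (fun n y _ => (hasDerivAt_pow n y).const_mul _) ?_ ?_
    (summable_halfCoeff_mul_pow hc (by simp)) (abs_lt.1 hzr)
  · intro n y hy
    have hy' : |y| ≤ r := abs_le.2 ⟨hy.1.le, hy.2.le⟩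
    have := halfCoeff_pos (by linarith : 0 < c) n
    rw [norm_mul, norm_mul, norm_pow, Real.norm_eq_abs, Real.norm_eq_abs, Real.norm_eq_abs,
      abs_of_pos this, Nat.abs_cast]
    gcongr
  · have := (abs_nonneg z).trans_lt hzr
    exact ⟨by linarith, this⟩

/-- The first-order inhomogeneous equation `z (1 - z) Φ' = (c - 1) (1 - Φ) + z Φ / 2` satisfied by
`Φ = ₂F₁(1, 1/2; c; ·)`, which comes from its two-term recursion. -/
lemma hypergeometric_one_half_ode {c : ℝ} (hc : 1 / 2 ≤ c) {z : ℝ} (hz : |z| < 1) :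
    z * (1 - z) * ∑' n : ℕ, halfCoeff c n * (n * z ^ (n - 1)) =
      (c - 1) * (1 - ordinaryHypergeometric (1 : ℝ) (1 / 2 : ℝ) c z) +
        z * ordinaryHypergeometric (1 : ℝ) (1 / 2 : ℝ) c z / 2 := by
  rw [hypergeometric_one_half_eq_tsum]
  have hS := (summable_halfCoeff_mul_pow hc hz).hasSum
  have hD := (summable_nat_mul_halfCoeff_mul_pow hc hz).hasSum
  set Φ := ∑' n, halfCoeff c n * z ^ n
  set D := ∑' n : ℕ, halfCoeff c n * (n * z ^ (n - 1))
  have hS1 := (hasSum_nat_add_iff' 1).2 hS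
  have hD1 := (hasSum_nat_add_iff' 1).2 hD
  simp only [Finset.range_one, Finset.sum_singleton, halfCoeff_zero, pow_zero, mul_one,
    Nat.cast_zero, zero_mul, mul_zero, sub_zero, Nat.add_sub_cancel] at hS1 hD1
  have hleft := (hD1.mul_left z).add (hS1.mul_left (c - 1))
  have hDz : HasSum (fun n : ℕ => halfCoeff c n * (n * z ^ n)) (z * D) := by
    have e : (fun n : ℕ => halfCoeff c n * (n * z ^ n)) =
        fun n : ℕ => z * (halfCoeff c n * (n * z ^ (n - 1))) := by
      funext n
      rcases n with _ | n
      · simp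
      · rw [Nat.add_sub_cancel]; ring
    rw [e]
    exact hD.mul_left z
  have hright := (hS.mul_left (z / 2)).add (hDz.mul_left z)
  have : z * D + (c - 1) * (Φ - 1) = z / 2 * Φ + z * (z * D) := by
    refine hleft.unique ?_
    convert hright using 2 with n
    have h := halfCoeff_succ (by linarith : 0 < c) n
    push_cast
    linear_combination z ^ (n + 1) * h
  linear_combination this

/-- `z ↦ z ^ (1/2 - s) (1 - z) ^ s ₂F₁(1, 1/2; 3/2 - s; z)` is, up to a constant factor and an
additive constant, an incomplete beta function. -/
lemma hasDerivAt_rpow_mul_hypergeometric {s : ℝ} (hs1 : s < 1) {z : ℝ} (hz0 : 0 < z)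
    (hz1 : z < 1) :
    HasDerivAt (fun z : ℝ => z ^ (1 / 2 - s) * (1 - z) ^ s *
        ordinaryHypergeometric (1 : ℝ) (1 / 2 : ℝ) (3 / 2 - s) z)
      ((1 / 2 - s) * z ^ (-(1 / 2) - s) * (1 - z) ^ (s - 1)) z := by
  have hc : (1 : ℝ) / 2 ≤ 3 / 2 - s := by linarith
  have hz : |z| < 1 := by rwa [abs_of_pos hz0]
  have hw : 0 < 1 - z := by linarith
  have h1 : HasDerivAt (fun z : ℝ => z ^ (1 / 2 - s)) ((1 / 2 - s) * z ^ (1 / 2 - s - 1)) z :=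
    Real.hasDerivAt_rpow_const (Or.inl hz0.ne')
  have h2 : HasDerivAt (fun z : ℝ => (1 - z) ^ s) (-1 * s * (1 - z) ^ (s - 1)) z :=
    ((hasDerivAt_id z).const_sub 1).rpow_const (Or.inl hw.ne')
  refine ((h1.mul h2).mul (hasDerivAt_hypergeometric_one_half hc hz)).congr_deriv ?_
  have hode := hypergeometric_one_half_ode hc hz
  set Φ := ordinaryHypergeometric (1 : ℝ) (1 / 2 : ℝ) (3 / 2 - s) z
  set D := ∑' n : ℕ, halfCoeff (3 / 2 - s) n * (n * z ^ (n - 1))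
  have e1 : z ^ (1 / 2 - s) = z ^ (-(1 / 2) - s) * z := by
    rw [← Real.rpow_add_one hz0.ne']; ring_nf
  have e2 : (1 - z) ^ s = (1 - z) ^ (s - 1) * (1 - z) := by
    rw [← Real.rpow_add_one hw.ne']; ring_nf
  rw [show (1 : ℝ) / 2 - s - 1 = -(1 / 2) - s by ring]
  simp only [Pi.mul_apply]
  rw [e1, e2]
  linear_combination z ^ (-(1 / 2) - s) * (1 - z) ^ (s - 1) * hode

lemma integral_rpow_mul_one_sub_rpow {a b : ℝ} (ha : 0 < a) (hb : 0 < b) :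
    ∫ t in (0 : ℝ)..1, t ^ (a - 1) * (1 - t) ^ (b - 1) =
      Real.Gamma a * Real.Gamma b / Real.Gamma (a + b) := by
  have h : ((∫ t in (0 : ℝ)..1, t ^ (a - 1) * (1 - t) ^ (b - 1) : ℝ) : ℂ) =
      Complex.betaIntegral a b := by
    rw [← intervalIntegral.integral_ofReal, Complex.betaIntegral]
    refine intervalIntegral.integral_congr fun t ht => ?_
    rw [uIcc_of_le zero_le_one] at ht
    push_cast [Complex.ofReal_cpow ht.1, Complex.ofReal_cpow (sub_nonneg.2 ht.2)]
    rfl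
  have h2 := ProbabilityTheory.beta_eq_betaIntegralReal a b ha hb
  rw [ProbabilityTheory.beta, ← h, Complex.ofReal_re] at h2
  exact h2.symm

lemma intervalIntegrable_rpow_mul_one_sub_rpow {a b : ℝ} (ha : 0 < a) (hb : 0 < b) :
    IntervalIntegrable (fun t : ℝ => t ^ (a - 1) * (1 - t) ^ (b - 1)) volume 0 1 := by
  have h := Complex.betaIntegral_convergent (u := a) (v := b) (by simpa) (by simpa)
  rw [intervalIntegrable_iff_integrableOn_Ioc_of_le zero_le_one] at h ⊢
  refine h.re.congr ?_
  refine (ae_restrict_iff' measurableSet_Ioc).2 (Eventually.of_forall fun t ht => ?_)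
  have e1 := Complex.ofReal_cpow ht.1.le (a - 1)
  have e2 := Complex.ofReal_cpow (sub_nonneg.2 ht.2) (b - 1)
  push_cast at e1 e2
  simp only
  rw [← e1, ← e2, ← Complex.ofReal_mul]
  exact Complex.ofReal_re _

/-- Splitting off the constant term of `₂F₁` leaves an incomplete beta function that is integrable
at `0` for every `s < 1`, including `s > 1/2`. -/
lemma rpow_mul_hypergeometric_eq {s : ℝ} (hs0 : 0 < s) (hs1 : s < 1) {z : ℝ} (hz0 : 0 < z)
    (hz1 : z < 1) :
    z ^ (1 / 2 - s) * (1 - z) ^ s *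
        ordinaryHypergeometric (1 : ℝ) (1 / 2 : ℝ) (3 / 2 - s) z =
      z ^ (1 / 2 - s) * (1 - z) ^ s +
        1 / 2 * ∫ t in (0 : ℝ)..z, t ^ (3 / 2 - s - 1) * (1 - t) ^ (s - 1) := by
  set F : ℝ → ℝ := ordinaryHypergeometric (1 : ℝ) (1 / 2 : ℝ) (3 / 2 - s) with hF
  -- Subtracting `1` from `F` makes `d` tend to `0` at `0`: it brings a factor `z ^ (3/2 - s)`.
  set k : ℝ → ℝ := fun t => t ^ (3 / 2 - s - 1) * (1 - t) ^ (s - 1) with hk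
  set d : ℝ → ℝ := fun z => z ^ (1 / 2 - s) * (1 - z) ^ s * F z - z ^ (1 / 2 - s) * (1 - z) ^ s -
    1 / 2 * ∫ t in (0 : ℝ)..z, k t with hd
  have hint : IntervalIntegrable k volume 0 1 :=
    intervalIntegrable_rpow_mul_one_sub_rpow (by linarith) hs0
  have hderiv : ∀ x ∈ Ioo (0 : ℝ) 1, HasDerivAt d 0 x := by
    rintro x ⟨hx0, hx1⟩
    have hw : 0 < 1 - x := by linarith
    have h1 : HasDerivAt (fun z : ℝ => z ^ (1 / 2 - s)) ((1 / 2 - s) * x ^ (1 / 2 - s - 1)) x :=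
      Real.hasDerivAt_rpow_const (Or.inl hx0.ne')
    have h2 : HasDerivAt (fun z : ℝ => (1 - z) ^ s) (-1 * s * (1 - x) ^ (s - 1)) x :=
      ((hasDerivAt_id x).const_sub 1).rpow_const (Or.inl hw.ne')
    have hkc : ∀ y ∈ Ioo (0 : ℝ) 1, ContinuousAt k y := fun y hy =>
      (Real.continuousAt_rpow_const y _ (Or.inl hy.1.ne')).mul
        ((continuousAt_const.sub continuousAt_id).rpow_const
          (Or.inl (sub_pos.2 hy.2).ne'))
    have h3 : HasDerivAt (fun z => ∫ t in (0 : ℝ)..z, k t) (k x) x := by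
      refine intervalIntegral.integral_hasDerivAt_right
        (hint.mono_set ?_) ?_ (hkc x ⟨hx0, hx1⟩)
      · rw [uIcc_of_le hx0.le, uIcc_of_le zero_le_one]
        exact Icc_subset_Icc_right hx1.le
      · exact (ContinuousOn.stronglyMeasurableAtFilter isOpen_Ioo
          (fun y hy => (hkc y hy).continuousWithinAt)) x ⟨hx0, hx1⟩
    refine (((hasDerivAt_rpow_mul_hypergeometric hs1 hx0 hx1).sub (h1.mul h2)).sub
      (h3.const_mul (1 / 2))).congr_deriv ?_
    have e1 : x ^ (1 / 2 - s) = x ^ (-(1 / 2) - s) * x := by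
      rw [← Real.rpow_add_one hx0.ne']; ring_nf
    have e2 : (1 - x) ^ s = (1 - x) ^ (s - 1) * (1 - x) := by
      rw [← Real.rpow_add_one hw.ne']; ring_nf
    rw [show (1 : ℝ) / 2 - s - 1 = -(1 / 2) - s by ring, hk]
    simp only
    rw [show (3 : ℝ) / 2 - s - 1 = 1 / 2 - s by ring, e1, e2]
    ring
  have hconst : ∀ x ∈ Ioo (0 : ℝ) 1, d x = d z := fun x hx =>
    isOpen_Ioo.is_const_of_deriv_eq_zero isPreconnected_Ioo
      (fun y hy => (hderiv y hy).differentiableAt.differentiableWithinAt)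
      (fun y hy => (hderiv y hy).deriv) hx ⟨hz0, hz1⟩
  have hlim : Tendsto d (𝓝[>] 0) (𝓝 0) := by
    have hF1 := (hasDerivAt_hypergeometric_one_half (c := 3 / 2 - s) (z := 0) (by linarith)
      (by simp)).tendsto_slope_zero_right
    have hpow : Tendsto (fun x : ℝ => x ^ (3 / 2 - s)) (𝓝[>] 0) (𝓝 0) := by
      have := (Real.continuousAt_rpow_const 0 (3 / 2 - s) (Or.inr (by linarith))).tendsto
      rw [Real.zero_rpow (by linarith)] at this
      exact this.mono_left nhdsWithin_le_nhds
    have hone : Tendsto (fun x : ℝ => (1 - x) ^ s) (𝓝[>] 0) (𝓝 1) := by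
      have : Continuous fun x : ℝ => (1 - x) ^ s :=
        (continuous_const.sub continuous_id).rpow_const fun _ => Or.inr hs0.le
      have := this.tendsto 0
      simp only [sub_zero, Real.one_rpow] at this
      exact this.mono_left nhdsWithin_le_nhds
    have hI : Tendsto (fun x : ℝ => ∫ t in (0 : ℝ)..x, k t) (𝓝[>] 0) (𝓝 0) := by
      have hc := intervalIntegral.continuousOn_primitive_interval' hint left_mem_uIcc
      rw [uIcc_of_le zero_le_one] at hc
      have := (hc 0 (by simp)).tendsto
      rw [intervalIntegral.integral_same] at this
      exact this.mono_left (nhdsWithin_le_of_mem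
        (mem_of_superset (Ioo_mem_nhdsGT zero_lt_one) Ioo_subset_Icc_self))
    have hall := ((hpow.mul hone).mul hF1).sub (hI.const_mul (1 / 2))
    simp only [zero_mul, mul_zero, sub_zero, zero_add, ordinaryHypergeometric_zero,
      smul_eq_mul] at hall
    refine hall.congr' ?_
    filter_upwards [self_mem_nhdsWithin] with x (hx : 0 < x)
    have e : x ^ (3 / 2 - s) = x ^ (1 / 2 - s) * x := by
      rw [← Real.rpow_add_one hx.ne']; ring_nf
    rw [e]
    simp only [hd, hF]
    field_simp
  have hdz : d z = 0 := by
    refine tendsto_nhds_unique (tendsto_const_nhds.congr' ?_) hlim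
    filter_upwards [Ioo_mem_nhdsGT zero_lt_one] with x hx
    exact (hconst x hx).symm
  simp only [hd] at hdz
  linarith

/-- The boundary value is half of the beta integral `B(3/2 - s, s)`; this is Gauss's summation
theorem in the case needed here. -/
lemma tendsto_rpow_mul_hypergeometric_one {s : ℝ} (hs0 : 0 < s) (hs1 : s < 1) :
    Tendsto (fun z : ℝ => z ^ (1 / 2 - s) * (1 - z) ^ s *
        ordinaryHypergeometric (1 : ℝ) (1 / 2 : ℝ) (3 / 2 - s) z) (𝓝[<] 1)
      (𝓝 (Real.Gamma (3 / 2 - s) * Real.Gamma s / Real.sqrt Real.pi)) := by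
  have hint := intervalIntegrable_rpow_mul_one_sub_rpow (show 0 < 3 / 2 - s by linarith) hs0
  have hI : Tendsto (fun x : ℝ => ∫ t in (0 : ℝ)..x, t ^ (3 / 2 - s - 1) * (1 - t) ^ (s - 1))
      (𝓝[<] 1) (𝓝 (2 * (Real.Gamma (3 / 2 - s) * Real.Gamma s / Real.sqrt Real.pi))) := by
    have hc := intervalIntegral.continuousOn_primitive_interval' hint left_mem_uIcc
    rw [uIcc_of_le zero_le_one] at hc
    have := (hc 1 (by simp)).tendsto
    rw [integral_rpow_mul_one_sub_rpow (by linarith) hs0, sub_add_cancel,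
      show (3 : ℝ) / 2 = 1 / 2 + 1 by norm_num, Real.Gamma_add_one (by norm_num),
      Real.Gamma_one_half_eq] at this
    rw [show (3 : ℝ) / 2 = 1 / 2 + 1 by norm_num]
    convert this.mono_left (nhdsWithin_le_of_mem
        (mem_of_superset (Ioo_mem_nhdsLT zero_lt_one) Ioo_subset_Icc_self)) using 2
    have : 0 < Real.sqrt Real.pi := Real.sqrt_pos.2 Real.pi_pos
    field_simp
  have hfirst : Tendsto (fun z : ℝ => z ^ (1 / 2 - s) * (1 - z) ^ s) (𝓝[<] 1) (𝓝 0) := by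
    have h1 : ContinuousAt (fun z : ℝ => z ^ (1 / 2 - s) * (1 - z) ^ s) 1 :=
      (Real.continuousAt_rpow_const 1 _ (Or.inl one_ne_zero)).mul
        ((continuousAt_const.sub continuousAt_id).rpow_const (Or.inr hs0.le))
    have := h1.tendsto
    simp only [sub_self, Real.zero_rpow hs0.ne', mul_zero] at this
    exact this.mono_left nhdsWithin_le_nhds
  have hall := hfirst.add (hI.const_mul (1 / 2))
  rw [zero_add, show ∀ x : ℝ, 1 / 2 * (2 * x) = x from fun x => by ring] at hall
  refine hall.congr' ?_
  filter_upwards [Ioo_mem_nhdsLT zero_lt_one] with z hz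
  exact (rpow_mul_hypergeometric_eq hs0 hs1 hz.1 hz.2).symm

/-! ### The exterior formulas -/

/-- The function equal to `1` on `[-1, 1]` and to `f |x|` outside. -/
noncomputable def capExtension (f : ℝ → ℝ) (x : ℝ) : ℝ := if |x| ≤ 1 then 1 else f |x|

lemma capExtension_of_abs_le {f : ℝ → ℝ} {x : ℝ} (h : |x| ≤ 1) : capExtension f x = 1 := if_pos h

lemma capExtension_of_one_lt_abs {f : ℝ → ℝ} {x : ℝ} (h : 1 < |x|) :
    capExtension f x = f |x| := if_neg h.not_ge

/-- A primitive of `κ (x² - 1) ^ (s - 1)` on `(1, ∞)` with boundary value `1` extends to an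
electrified profile. -/
lemma isElectrifiedProfile_capExtension {s κ : ℝ} {f : ℝ → ℝ}
    (hf : ∀ x, 1 < x → HasDerivAt f (κ * (x ^ 2 - 1) ^ (s - 1)) x)
    (h1 : Tendsto f (𝓝[>] 1) (𝓝 1)) : IsElectrifiedProfile s κ (capExtension f) where
  continuous := by
    suffices Continuous fun r : ℝ => if r ≤ 1 then 1 else f r from this.comp continuous_abs
    rw [continuous_iff_continuousAt]
    intro r
    rcases lt_trichotomy r 1 with h | rfl | h
    · refine (continuousAt_const (y := (1 : ℝ))).congr ?_
      filter_upwards [Iio_mem_nhds h] with y (hy : y < 1)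
      rw [if_pos hy.le]
    · rw [ContinuousAt, if_pos le_rfl]
      nth_rewrite 1 [← nhdsLE_sup_nhdsGT]
      refine tendsto_sup.2 ⟨?_, ?_⟩
      · refine tendsto_const_nhds.congr' ?_
        filter_upwards [self_mem_nhdsWithin] with y (hy : y ≤ 1)
        rw [if_pos hy]
      · refine h1.congr' ?_
        filter_upwards [self_mem_nhdsWithin] with y (hy : 1 < y)
        rw [if_neg hy.not_ge]
    · refine (hf r h).continuousAt.congr ?_
      filter_upwards [Ioi_mem_nhds h] with y (hy : 1 < y)
      rw [if_neg hy.not_ge]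
  even x := by simp [capExtension]
  eq_of_abs_le x hx := by
    rw [capExtension_of_abs_le hx, capExtension_of_abs_le (by simp)]
  hasDerivAt x hx := by
    refine (hf x hx).congr_of_eventuallyEq ?_
    filter_upwards [Ioi_mem_nhds hx] with y (hy : 1 < y)
    rw [capExtension_of_one_lt_abs (by rwa [abs_of_pos (by linarith)]), abs_of_pos (by linarith)]

lemma IsElectrifiedProfile.not_const {s κ : ℝ} {g : ℝ → ℝ} (hg : IsElectrifiedProfile s κ g)
    (hκ : κ ≠ 0) : ¬ ∃ c : ℝ, ∀ x, g x = c := by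
  rintro ⟨c, hc⟩
  have h1 := hg.hasDerivAt 2 (by norm_num)
  rw [show g = fun _ => c from funext hc] at h1
  have h2 := h1.unique (hasDerivAt_const 2 c)
  have h3 : (0 : ℝ) < (2 ^ 2 - 1) ^ (s - 1) := Real.rpow_pos_of_pos (by norm_num) _
  exact mul_ne_zero hκ h3.ne' h2

lemma IsElectrifiedProfile.isElectrifiedDiskSolution {s κ : ℝ} {f : ℝ → ℝ}
    (hg : IsElectrifiedProfile s κ (capExtension f)) (hs0 : 0 < s) (hs1 : s < 1) :
    IsElectrifiedDiskSolution s (capExtension f) where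
  fracLaplacian_eq_zero _ hX := hg.hasFracLaplacianAt hs0 hs1 hX
  eq_one _ hX := capExtension_of_abs_le hX.le

/-- The exterior formula for `s ≠ 1/2`. -/
noncomputable def exteriorHypergeometric (s x : ℝ) : ℝ :=
  farFieldConst s * x ^ (2 * s - 1) * (1 - 1 / x ^ 2) ^ s *
    ordinaryHypergeometric (1 : ℝ) (1 / 2 : ℝ) (3 / 2 - s) (1 / x ^ 2)

/-- The exterior formula for `s = 1/2`. -/
noncomputable def exteriorLog (x : ℝ) : ℝ := 1 - Real.log (x + Real.sqrt (x ^ 2 - 1))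

lemma farFieldConst_pos {s : ℝ} (hs0 : 0 < s) (hs1 : s < 1) : 0 < farFieldConst s :=
  div_pos (Real.Gamma_pos_of_pos (by norm_num))
    (mul_pos (Real.Gamma_pos_of_pos (by linarith)) (Real.Gamma_pos_of_pos hs0))

lemma exteriorHypergeometric_eq {s x : ℝ} (hx : 0 < x) :
    exteriorHypergeometric s x = farFieldConst s * ((1 / x ^ 2) ^ (1 / 2 - s) *
      (1 - 1 / x ^ 2) ^ s *
      ordinaryHypergeometric (1 : ℝ) (1 / 2 : ℝ) (3 / 2 - s) (1 / x ^ 2)) := by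
  have e : (1 / x ^ 2) ^ (1 / 2 - s) = x ^ (2 * s - 1) := by
    rw [one_div, Real.inv_rpow (by positivity), ← Real.rpow_neg (by positivity),
      ← Real.rpow_natCast, ← Real.rpow_mul hx.le]
    congr 1
    push_cast
    ring
  rw [e, exteriorHypergeometric]
  ring

lemma one_div_sq_lt_one {x : ℝ} (hx : 1 < x) : 1 / x ^ 2 < 1 := by
  rw [div_lt_one (by positivity)]; nlinarith

lemma hasDerivAt_exteriorHypergeometric {s x : ℝ} (hs1 : s < 1) (hx : 1 < x) :
    HasDerivAt (exteriorHypergeometric s)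
      (farFieldConst s * (2 * s - 1) * (x ^ 2 - 1) ^ (s - 1)) x := by
  have hx0 : 0 < x := by linarith
  have hz : HasDerivAt (fun x : ℝ => 1 / x ^ 2) (-(2 * x) / (x ^ 2) ^ 2) x := by
    simp only [one_div]
    exact ((hasDerivAt_pow 2 x).fun_inv (by positivity)).congr_deriv (by simp)
  have h := ((hasDerivAt_rpow_mul_hypergeometric hs1 (z := 1 / x ^ 2) (by positivity)
    (one_div_sq_lt_one hx)).comp x hz).const_mul (farFieldConst s)
  refine (h.congr_of_eventuallyEq ?_).congr_deriv ?_
  · filter_upwards [Ioi_mem_nhds hx0] with y hy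
    exact exteriorHypergeometric_eq hy
  · have e1 : (x ^ 2 - 1) ^ (s - 1) = (x ^ 2) ^ (s - 1) * (1 - 1 / x ^ 2) ^ (s - 1) := by
      rw [← Real.mul_rpow (by positivity) (sub_nonneg.2 (one_div_sq_lt_one hx).le)]
      congr 1
      field_simp
    have e2 : (1 / x ^ 2) ^ (-(1 / 2) - s) = (x ^ 2) ^ (s - 1) * x ^ 3 := by
      rw [one_div, Real.inv_rpow (by positivity), ← Real.rpow_neg (by positivity),
        ← Real.rpow_natCast, ← Real.rpow_natCast, ← Real.rpow_mul hx0.le, ← Real.rpow_mul hx0.le,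
        ← Real.rpow_add hx0]
      congr 1
      push_cast
      ring
    rw [e1, e2]
    field_simp
    ring

lemma tendsto_exteriorHypergeometric_one {s : ℝ} (hs0 : 0 < s) (hs1 : s < 1) :
    Tendsto (exteriorHypergeometric s) (𝓝[>] 1) (𝓝 1) := by
  have hz : Tendsto (fun x : ℝ => 1 / x ^ 2) (𝓝[>] 1) (𝓝[<] 1) := by
    refine tendsto_nhdsWithin_iff.2 ⟨?_, ?_⟩
    · have : ContinuousAt (fun x : ℝ => 1 / x ^ 2) 1 :=
        continuousAt_const.div (by fun_prop) (by norm_num)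
      have := this.tendsto
      norm_num only [one_pow, div_one] at this
      exact this.mono_left nhdsWithin_le_nhds
    · filter_upwards [self_mem_nhdsWithin] with x hx
      exact one_div_sq_lt_one hx
  have h := ((tendsto_rpow_mul_hypergeometric_one hs0 hs1).comp hz).const_mul (farFieldConst s)
  have e : farFieldConst s * (Real.Gamma (3 / 2 - s) * Real.Gamma s / Real.sqrt Real.pi) = 1 := by
    have h1 : 0 < Real.Gamma (3 / 2 - s) := Real.Gamma_pos_of_pos (by linarith)
    have h2 : 0 < Real.Gamma s := Real.Gamma_pos_of_pos hs0
    have h3 : 0 < Real.sqrt Real.pi := Real.sqrt_pos.2 Real.pi_pos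
    rw [farFieldConst, Real.Gamma_one_half_eq, div_mul_div_comm, mul_comm (Real.sqrt Real.pi)]
    exact div_self (by positivity)
  rw [e] at h
  refine h.congr' ?_
  filter_upwards [self_mem_nhdsWithin] with x (hx : 1 < x)
  exact (exteriorHypergeometric_eq (by linarith)).symm

lemma hasDerivAt_exteriorLog {x : ℝ} (hx : 1 < x) :
    HasDerivAt exteriorLog (-1 * (x ^ 2 - 1) ^ ((1 : ℝ) / 2 - 1)) x := by
  have hq : 0 < x ^ 2 - 1 := by nlinarith
  have hr : 0 < Real.sqrt (x ^ 2 - 1) := Real.sqrt_pos.2 hq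
  have h1 : HasDerivAt (fun x : ℝ => x ^ 2 - 1) (2 * x) x := by
    simpa using (hasDerivAt_pow 2 x).sub_const 1
  have h2 := ((hasDerivAt_id x).add (h1.sqrt hq.ne')).log
    (show x + Real.sqrt (x ^ 2 - 1) ≠ 0 by positivity)
  refine (h2.const_sub 1).congr_deriv ?_
  rw [show (1 : ℝ) / 2 - 1 = -(1 / 2) by norm_num, Real.rpow_neg hq.le, ← Real.sqrt_eq_rpow]
  have : x + Real.sqrt (x ^ 2 - 1) ≠ 0 := by positivity
  simp only [Pi.add_apply, id]
  field_simp
  ring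

lemma tendsto_exteriorLog_one : Tendsto exteriorLog (𝓝[>] 1) (𝓝 1) := by
  have h : ContinuousAt exteriorLog 1 :=
    continuousAt_const.sub (ContinuousAt.log (by fun_prop) (by simp))
  have := h.tendsto
  simp only [exteriorLog, one_pow, sub_self, Real.sqrt_zero, add_zero, Real.log_one,
    sub_zero] at this
  exact this.mono_left nhdsWithin_le_nhds

/-! ### Far-field expansions -/

lemma tendsto_one_div_sq_cobounded :
    Tendsto (fun x : ℝ => 1 / x ^ 2) (Bornology.cobounded ℝ) (𝓝 0) := by
  have h := ((tendsto_pow_atTop two_ne_zero).comp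
    (tendsto_norm_cobounded_atTop (E := ℝ))).inv_tendsto_atTop
  refine h.congr fun x => ?_
  simp [one_div]

lemma eventually_one_lt_abs_cobounded : ∀ᶠ x : ℝ in Bornology.cobounded ℝ, 1 < |x| :=
  (tendsto_norm_cobounded_atTop (E := ℝ)).eventually_gt_atTop 1

/-- `(1 - z) ^ s ₂F₁(1, 1/2; 3/2 - s; z) - 1 = O(z)` at `z = 0`, with `z = 1 / x²`. -/
lemma isBigO_capExtension_exteriorHypergeometric {s : ℝ} (hs0 : 0 < s) (hs1 : s < 1) :
    (fun x => capExtension (exteriorHypergeometric s) x - farFieldConst s * |x| ^ (2 * s - 1))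
      =O[Bornology.cobounded ℝ] fun x => |x| ^ (2 * s - 3) := by
  have hF := hasDerivAt_hypergeometric_one_half (c := 3 / 2 - s) (z := 0) (by linarith) (by simp)
  have hp : HasDerivAt (fun z : ℝ => (1 - z) ^ s) (-1 * s * (1 - 0) ^ (s - 1)) 0 :=
    ((hasDerivAt_id (0 : ℝ)).const_sub 1).rpow_const (Or.inl (by simp))
  have hO := ((hp.mul hF).differentiableAt.isBigO_sub).comp_tendsto tendsto_one_div_sq_cobounded
  have hall := (Asymptotics.isBigO_refl (fun x : ℝ => farFieldConst s * |x| ^ (2 * s - 1))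
    (Bornology.cobounded ℝ)).mul hO
  refine (hall.congr' ?_ ?_).trans
    (Asymptotics.isBigO_const_mul_self (farFieldConst s) (fun x : ℝ => |x| ^ (2 * s - 3)) _)
  · filter_upwards [eventually_one_lt_abs_cobounded] with x hx
    rw [capExtension_of_one_lt_abs hx, exteriorHypergeometric, sq_abs]
    simp
    ring
  · filter_upwards [eventually_one_lt_abs_cobounded] with x hx
    have hx0 : 0 < |x| := by linarith
    have e : |x| ^ (2 * s - 1) = |x| ^ (2 * s - 3) * |x| ^ 2 := by
      rw [← Real.rpow_natCast, ← Real.rpow_add hx0]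
      congr 1
      push_cast
      ring
    simp only [Function.comp, sub_zero]
    rw [e, ← sq_abs x]
    field_simp

/-- The difference is `-log ((1 + √(1 - z)) / 2)`, which is `O(z)` at `z = 0`, with `z = 1 / x²`. -/
lemma isBigO_capExtension_exteriorLog :
    (fun x => capExtension exteriorLog x - (-Real.log (2 * |x|) + 1))
      =O[Bornology.cobounded ℝ] fun x => (x ^ 2)⁻¹ := by
  have h1 : DifferentiableAt ℝ (fun z : ℝ => -Real.log ((1 + Real.sqrt (1 - z)) / 2)) 0 := by
    refine (DifferentiableAt.log ?_ (by norm_num)).neg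
    refine ((DifferentiableAt.sqrt (by fun_prop) (by norm_num)).const_add 1).div_const 2
  have hO := h1.isBigO_sub.comp_tendsto tendsto_one_div_sq_cobounded
  refine hO.congr' ?_ (Eventually.of_forall fun x => by simp)
  filter_upwards [eventually_one_lt_abs_cobounded] with x hx
  have hx0 : 0 < |x| := by linarith
  have hs : Real.sqrt (|x| ^ 2 - 1) = |x| * Real.sqrt (1 - 1 / x ^ 2) := by
    rw [← sq_abs x, show |x| ^ 2 - 1 = |x| ^ 2 * (1 - 1 / |x| ^ 2) by field_simp,
      Real.sqrt_mul (by positivity), Real.sqrt_sq hx0.le]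
  have hq : 0 < 1 + Real.sqrt (1 - 1 / x ^ 2) := by positivity
  rw [capExtension_of_one_lt_abs hx, exteriorLog, hs,
    show |x| + |x| * Real.sqrt (1 - 1 / x ^ 2) =
      2 * |x| * ((1 + Real.sqrt (1 - 1 / x ^ 2)) / 2) by ring,
    Real.log_mul (by positivity) (by positivity)]
  simp only [Function.comp, sub_zero, Real.sqrt_one]
  norm_num
  ring

theorem proposition2p1 (s : ℝ) (hs0 : 0 < s) (hs1 : s < 1) :
    ∃ W : ℝ → ℝ,
      IsElectrifiedDiskSolution s W ∧
      (¬ ∃ c : ℝ, ∀ X : ℝ, W X = c) ∧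
      (∀ X : ℝ, |X| ≤ 1 → W X = 1) ∧
      (s ≠ 1 / 2 →
        (∀ X : ℝ, 1 < |X| →
          W X = Real.sqrt Real.pi / (Real.Gamma s * Real.Gamma (3 / 2 - s)) *
            |X| ^ (2 * s - 1) * (1 - 1 / X ^ 2) ^ s *
            ordinaryHypergeometric (1 : ℝ) (1 / 2 : ℝ) (3 / 2 - s) (1 / X ^ 2 : ℝ)) ∧
        Asymptotics.IsBigO (Bornology.cobounded ℝ)
          (fun X : ℝ => W X - farFieldConst s * |X| ^ (2 * s - 1))
          (fun X : ℝ => |X| ^ (2 * s - 3))) ∧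
      (s = 1 / 2 →
        (∀ X : ℝ, 1 < |X| → W X = 1 - Real.log (|X| + Real.sqrt (X ^ 2 - 1))) ∧
        Asymptotics.IsBigO (Bornology.cobounded ℝ)
          (fun X : ℝ => W X - (-Real.log (2 * |X|) + 1))
          (fun X : ℝ => (X ^ 2)⁻¹)) := by
  by_cases hs : s = 1 / 2
  · subst hs
    have hg := isElectrifiedProfile_capExtension (fun x hx => hasDerivAt_exteriorLog hx)
      tendsto_exteriorLog_one
    refine ⟨capExtension exteriorLog, hg.isElectrifiedDiskSolution hs0 hs1,
      hg.not_const (by norm_num), fun X hX => capExtension_of_abs_le hX,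
      fun h => absurd rfl h, fun _ => ⟨fun X hX => ?_, isBigO_capExtension_exteriorLog⟩⟩
    rw [capExtension_of_one_lt_abs hX, exteriorLog, sq_abs]
  · have hg := isElectrifiedProfile_capExtension
      (fun x hx => hasDerivAt_exteriorHypergeometric hs1 hx)
      (tendsto_exteriorHypergeometric_one hs0 hs1)
    have hκ : farFieldConst s * (2 * s - 1) ≠ 0 :=
      mul_ne_zero (farFieldConst_pos hs0 hs1).ne' fun h => hs (by linarith)
    refine ⟨capExtension (exteriorHypergeometric s), hg.isElectrifiedDiskSolution hs0 hs1,
      hg.not_const hκ, fun X hX => capExtension_of_abs_le hX,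
      fun _ => ⟨fun X hX => ?_, isBigO_capExtension_exteriorHypergeometric hs0 hs1⟩,
      fun h => absurd h hs⟩
    rw [capExtension_of_one_lt_abs hX, exteriorHypergeometric, farFieldConst, sq_abs,
      Real.Gamma_one_half_eq, mul_comm (Real.Gamma s)]
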